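/- Let $R$ be an integral domain with quotient field $K$. Call $R$ an sQQR-domain if for every $u\in K$ the ring $R[u]$ is an intersection (inside $K$) of localizations $R_P$ of $R$ at prime ideals $P$, the empty intersection being $K$. Say that $R$ has Noetherian spectrum if it satisfies the ascending chain condition on radical ideals. If $R$ is an sQQR-domain with Noetherian spectrum, then $R$ is a Prüfer domain, that is, every nonzero finitely generated ideal of $R$ is invertible. -/

import Mathlib

open scoped nonZeroDivisors

/-- Let `R` be a domain with quotient field `K`. `R` is an sQQR-domain if each simple overring
`R[u]`, `u ∈ K`, is an intersection of localizations `R_P` (inside `K`) of `R` at prime ideals.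
The intersection of the empty family is `K`. -/
def IsSQQRDomain (R K : Type*) [CommRing R] [IsDomain R] [Field K] [Algebra R K]
    [IsFractionRing R K] : Prop :=
  ∀ u : K, ∃ Y : Set (PrimeSpectrum R),
    Algebra.adjoin R {u} =
      ⨅ P ∈ Y, Localization.subalgebra.ofField K P.asIdeal.primeCompl
        P.asIdeal.primeCompl_le_nonZeroDivisors

/-- `R` has Noetherian spectrum: every ascending chain of radical ideals of `R` is eventually
constant. -/
def HasNoetherianSpectrum (R : Type*) [CommRing R] : Prop :=
  ∀ I : ℕ →o Ideal R, (∀ n, (I n).IsRadical) → ∃ n, ∀ m, n ≤ m → I n = I m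

/-- `R`, a domain with quotient field `K`, is a Prüfer domain: every nonzero finitely generated
ideal is invertible, as a fractional ideal of `R` in `K`. -/
def IsPruferDomain (R K : Type*) [CommRing R] [IsDomain R] [Field K] [Algebra R K]
    [IsFractionRing R K] : Prop :=
  ∀ I : Ideal R, I ≠ ⊥ → I.FG → IsUnit (I : FractionalIdeal R⁰ K)

/-! Write `(A : x)` for `denomIdeal A x` and `T(I)` for `idealTransform K I`. The sQQR condition is
used only through `T((A : v)) ⊆ A[v]` for all `v` (`HasTransformSimpleOverrings`), which survives
localization when the spectrum is Noetherian. If `A` is integrally closed, `d v² ∈ A` gives `(d v)²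
∈ A`, so `d v ∈ A`; hence `v ∈ A[v²]` for every `v`, and this makes `A` Prüfer
(`isPruferDomain_of_forall_mem_adjoin_sq`). The main work is integral closedness. An integral
element outside `A` whose denominator ideal has maximal radical has a prime radical. Localizing
there gives a local ring `(A, M)` and an integral `u ∈ T(M) \ A`. Now `T = T(M)` lies in `A[v]` for
every `v ∉ A`. Some integral element escapes `T`, since otherwise `T` would be Prüfer and a finitely
generated ideal with radical `M` would generate the unit ideal of `T`, against lying over. Nakayama
then gives `w ∈ T \ A` with `w² ∈ A`. Using this at a prime attached to an integral element outside
`T` forces `u ∈ A` (`mem_bot_of_isIntegral_of_mem_idealTransform`). -/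

/-- The ideal of all `d` in `A` such that `d • x` lies in the image of `A` in `K`. -/
def denomIdeal (A : Type*) {K : Type*} [CommRing A] [CommRing K] [Algebra A K] (x : K) :
    Ideal A where
  carrier := {d | d • x ∈ (⊥ : Subalgebra A K)}
  add_mem' {a b} ha hb := by
    simp only [Set.mem_ofPred_eq, add_smul] at *
    exact add_mem ha hb
  zero_mem' := by simp
  smul_mem' c d hd := by
    simp only [Set.mem_ofPred_eq, smul_eq_mul, mul_smul] at *
    exact Subalgebra.smul_mem _ hd c

/-! ### Denominator ideals and ideal transforms. -/

section Denominators

variable {A K : Type*} [CommRing A] [CommRing K] [Algebra A K]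

theorem mem_denomIdeal {d : A} {x : K} :
    d ∈ denomIdeal A x ↔ d • x ∈ (⊥ : Subalgebra A K) := Iff.rfl

theorem mem_radical_denomIdeal {d : A} {x : K} :
    d ∈ (denomIdeal A x).radical ↔ ∃ n : ℕ, d ^ n • x ∈ (⊥ : Subalgebra A K) := Iff.rfl

theorem denomIdeal_eq_top_iff {x : K} : denomIdeal A x = ⊤ ↔ x ∈ (⊥ : Subalgebra A K) := by
  rw [Ideal.eq_top_iff_one, mem_denomIdeal, one_smul]

theorem denomIdeal_le_smul (a : A) (x : K) : denomIdeal A x ≤ denomIdeal A (a • x) := by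
  intro d hd
  rw [mem_denomIdeal, smul_comm]
  exact Subalgebra.smul_mem _ hd a

theorem pow_smul_mem_of_le {d : A} {x : K} {n m : ℕ} (h : n ≤ m)
    (hx : d ^ n • x ∈ (⊥ : Subalgebra A K)) : d ^ m • x ∈ (⊥ : Subalgebra A K) := by
  obtain ⟨k, rfl⟩ := Nat.exists_eq_add_of_le' h
  rw [pow_add, mul_smul]
  exact Subalgebra.smul_mem _ hx _

variable (K) in
/-- The overring of all `x` such that each element of `I` has a power multiplying `x` into `A`. -/
def idealTransform (I : Ideal A) : Subalgebra A K where
  carrier := {x | I ≤ (denomIdeal A x).radical}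
  mul_mem' {x y} hx hy d hd := by
    obtain ⟨n, hn⟩ := mem_radical_denomIdeal.1 (hx hd)
    obtain ⟨m, hm⟩ := mem_radical_denomIdeal.1 (hy hd)
    refine mem_radical_denomIdeal.2 ⟨n + m, ?_⟩
    rw [pow_add, ← smul_mul_smul_comm]
    exact mul_mem hn hm
  add_mem' {x y} hx hy d hd := by
    obtain ⟨n, hn⟩ := mem_radical_denomIdeal.1 (hx hd)
    obtain ⟨m, hm⟩ := mem_radical_denomIdeal.1 (hy hd)
    refine mem_radical_denomIdeal.2 ⟨n + m, ?_⟩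
    rw [smul_add]
    exact add_mem (pow_smul_mem_of_le (by simp) hn) (pow_smul_mem_of_le (by simp) hm)
  algebraMap_mem' a d _ :=
    mem_radical_denomIdeal.2 ⟨0, by simp⟩

theorem mem_idealTransform {I : Ideal A} {x : K} :
    x ∈ idealTransform K I ↔ I ≤ (denomIdeal A x).radical := Iff.rfl

theorem exists_eq_add_mul_of_mem_adjoin {x v : K} (hx : x ∈ Algebra.adjoin A {v}) :
    ∃ a : A, ∃ y ∈ Algebra.adjoin A {v}, x = algebraMap A K a + v * y := by
  rw [Algebra.adjoin_singleton_eq_range_aeval] at hx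
  obtain ⟨p, rfl⟩ := hx
  refine ⟨p.coeff 0, Polynomial.aeval v p.divX, Polynomial.aeval_mem_adjoin_singleton _ _, ?_⟩
  change Polynomial.aeval v p = _
  conv_lhs => rw [← Polynomial.X_mul_divX_add p]
  rw [map_add, map_mul, Polynomial.aeval_X, Polynomial.aeval_C, add_comm]

theorem exists_eq_add_smul_of_sq_mem {x v : K} (hv : v ^ 2 ∈ (⊥ : Subalgebra A K))
    (hx : x ∈ Algebra.adjoin A {v}) : ∃ a c : A, x = algebraMap A K a + c • v := by
  obtain ⟨s, hs⟩ := Algebra.mem_bot.1 hv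
  induction hx using Algebra.adjoin_induction with
  | mem y hy => exact ⟨0, 1, by simpa using hy⟩
  | algebraMap r => exact ⟨r, 0, by simp⟩
  | add y z _ _ hy hz =>
    obtain ⟨a, c, rfl⟩ := hy
    obtain ⟨b, d, rfl⟩ := hz
    refine ⟨a + b, c + d, ?_⟩
    simp only [Algebra.smul_def, map_add]; ring
  | mul y z _ _ hy hz =>
    obtain ⟨a, c, rfl⟩ := hy
    obtain ⟨b, d, rfl⟩ := hz
    refine ⟨a * b + c * d * s, a * d + b * c, ?_⟩
    simp only [Algebra.smul_def, map_add, map_mul, hs]; ring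

variable (A K) in
/-- Each simple overring `A[v]` contains every `x` that lies in all the localizations `A_P`
containing `v`, a condition that is expressed here by the denominator ideals of `x` and `v`. -/
def HasTransformSimpleOverrings : Prop :=
  ∀ v : K, idealTransform K (denomIdeal A v) ≤ Algebra.adjoin A {v}

end Denominators

/-! ### Noetherian spectrum. -/

section NoetherianSpectrum

variable {A : Type*} [CommRing A]

theorem HasNoetherianSpectrum.exists_maximal (hA : HasNoetherianSpectrum A) {ι : Type*}
    {p : ι → Prop} (f : ι → Ideal A) (i₀ : ι) (h₀ : p i₀) :
    ∃ i, p i ∧ ∀ j, p j → (f i).radical ≤ (f j).radical → (f j).radical ≤ (f i).radical := by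
  have hwf : WellFoundedGT {I : Ideal A // I.IsRadical} := by
    rw [wellFoundedGT_iff_monotone_chain_condition]
    intro a
    obtain ⟨n, hn⟩ := hA ⟨fun n => (a n).1, fun _ _ h => a.monotone h⟩ fun n => (a n).2
    exact ⟨n, fun m hm => Subtype.ext (hn m hm)⟩
  let g : ι → {I : Ideal A // I.IsRadical} := fun i => ⟨(f i).radical, Ideal.radical_isRadical _⟩
  obtain ⟨_, ⟨i, hi, rfl⟩, hmax⟩ :=
    hwf.wf.has_min (g '' {i | p i}) ⟨_, i₀, h₀, rfl⟩
  refine ⟨i, hi, fun j hj hij => ?_⟩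
  by_contra hji
  exact hmax (g j) ⟨j, hj, rfl⟩ (lt_of_le_not_ge hij hji)

theorem HasNoetherianSpectrum.exists_fg_le_radical (hA : HasNoetherianSpectrum A) (I : Ideal A) :
    ∃ J ≤ I, J.FG ∧ I ≤ J.radical := by
  obtain ⟨J, ⟨hJI, hJ⟩, hmax⟩ := hA.exists_maximal (p := fun J : Ideal A => J ≤ I ∧ J.FG) id ⊥
    ⟨bot_le, Submodule.fg_bot⟩
  refine ⟨J, hJI, hJ, fun x hx => ?_⟩
  have h := hmax (J ⊔ Ideal.span {x})
    ⟨sup_le hJI ((Ideal.span_singleton_le_iff_mem I).2 hx),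
      Submodule.FG.sup hJ (Submodule.fg_span_singleton x)⟩ (Ideal.radical_mono le_sup_left)
  exact h (Ideal.le_radical (le_sup_right (a := J) (Ideal.mem_span_singleton_self x)))

theorem HasNoetherianSpectrum.of_isLocalization (hA : HasNoetherianSpectrum A) (W : Submonoid A)
    (S : Type*) [CommRing S] [Algebra A S] [IsLocalization W S] : HasNoetherianSpectrum S := by
  intro I hI
  obtain ⟨n, hn⟩ := hA ⟨fun n => (I n).under A,
    fun _ _ h => Ideal.comap_mono (I.monotone h)⟩ fun n => (hI n).comap _
  refine ⟨n, fun m hm => ?_⟩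
  have h : (I n).under A = (I m).under A := hn m hm
  rw [← IsLocalization.map_under W S (I n), h, IsLocalization.map_under W S]

end NoetherianSpectrum

/-! ### Transforms under localization. -/

section Localization

variable {A S K : Type*} [CommRing A] [CommRing S] [Field K] [Algebra A S] [Algebra S K]
  [Algebra A K] [IsScalarTower A S K]

theorem mem_bot_of_mem_bot {x : K} (hx : x ∈ (⊥ : Subalgebra A K)) :
    x ∈ (⊥ : Subalgebra S K) := by
  obtain ⟨a, rfl⟩ := Algebra.mem_bot.1 hx
  rw [IsScalarTower.algebraMap_apply A S K]
  exact Subalgebra.algebraMap_mem _ _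

theorem mem_bot_iff_of_isLocalization (W : Submonoid A)
    [IsLocalization W S] {x : K} :
    x ∈ (⊥ : Subalgebra S K) ↔ ∃ s ∈ W, s • x ∈ (⊥ : Subalgebra A K) := by
  constructor
  · intro hx
    obtain ⟨y, rfl⟩ := Algebra.mem_bot.1 hx
    obtain ⟨⟨a, s⟩, h⟩ := IsLocalization.surj W y
    refine ⟨s, s.2, Algebra.mem_bot.2 ⟨a, ?_⟩⟩
    rw [IsScalarTower.algebraMap_apply A S K, ← h, map_mul, Algebra.smul_def,
      IsScalarTower.algebraMap_apply A S K, mul_comm]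
  · rintro ⟨s, hs, hx⟩
    obtain ⟨b, hb⟩ := (IsLocalization.map_units S (⟨s, hs⟩ : W)).exists_left_inv
    have h := Subalgebra.smul_mem _ (mem_bot_of_mem_bot (S := S) hx) b
    have e : b • s • x = x := by
      rw [← algebraMap_smul S s x, smul_smul, hb, one_smul]
    rwa [e] at h

theorem algebraMap_mem_radical_denomIdeal {a : A} {x : K}
    (h : a ∈ (denomIdeal A x).radical) : algebraMap A S a ∈ (denomIdeal S x).radical := by
  obtain ⟨n, hn⟩ := mem_radical_denomIdeal.1 h
  refine mem_radical_denomIdeal.2 ⟨n, ?_⟩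
  rw [← map_pow, algebraMap_smul]
  exact mem_bot_of_mem_bot hn

/-- Up to radical `I` has finitely many generators, so the denominators they require multiply to a
single `s`. -/
theorem HasNoetherianSpectrum.exists_smul_mem_idealTransform
    (hA : HasNoetherianSpectrum A) (W : Submonoid A) [IsLocalization W S]
    (I : Ideal A) {x : K} (hx : x ∈ idealTransform K (I.map (algebraMap A S))) :
    ∃ s ∈ W, s • x ∈ idealTransform K I := by
  obtain ⟨J, hJI, ⟨t, rfl⟩, hIJ⟩ := hA.exists_fg_le_radical I
  suffices h : ∃ s ∈ W, (t : Set A) ⊆ (denomIdeal A (s • x)).radical by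
    obtain ⟨s, hs, h⟩ := h
    exact ⟨s, hs, hIJ.trans ((Ideal.radical_isRadical _).radical_le_iff.2 (Ideal.span_le.2 h))⟩
  have key : ∀ j ∈ t, ∃ s ∈ W, j ∈ (denomIdeal A (s • x)).radical := by
    intro j hj
    obtain ⟨n, hn⟩ := mem_radical_denomIdeal.1
      (hx (Ideal.mem_map_of_mem _ (hJI (Ideal.subset_span hj))))
    rw [← map_pow, algebraMap_smul, mem_bot_iff_of_isLocalization W] at hn
    obtain ⟨s, hs, h⟩ := hn
    exact ⟨s, hs, mem_radical_denomIdeal.2 ⟨n, by rwa [smul_comm]⟩⟩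
  clear hIJ hJI
  classical
  induction t using Finset.induction_on with
  | empty => exact ⟨1, W.one_mem, by simp⟩
  | insert j t _ ih =>
    obtain ⟨s, hs, h⟩ := ih fun i hi => key i (Finset.mem_insert_of_mem hi)
    obtain ⟨r, hr, h'⟩ := key j (Finset.mem_insert_self j t)
    refine ⟨s * r, W.mul_mem hs hr, ?_⟩
    rw [Finset.coe_insert, Set.insert_subset_iff]
    constructor
    · rw [mul_smul]
      exact Ideal.radical_mono (denomIdeal_le_smul s _) h'
    · rw [mul_comm, mul_smul]
      exact h.trans (Ideal.radical_mono (denomIdeal_le_smul r _))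

theorem HasTransformSimpleOverrings.of_isLocalization
    (hA : HasNoetherianSpectrum A) (h : HasTransformSimpleOverrings A K) (W : Submonoid A)
    [IsLocalization W S] : HasTransformSimpleOverrings S K := by
  intro v x hx
  have hle : (denomIdeal A v).map (algebraMap A S) ≤ denomIdeal S v := by
    rw [Ideal.map_le_iff_le_comap]
    intro d hd
    rw [Ideal.mem_comap, mem_denomIdeal, algebraMap_smul]
    exact mem_bot_of_mem_bot hd
  obtain ⟨s, hs, hsx⟩ := hA.exists_smul_mem_idealTransform W _
    (mem_idealTransform.2 (hle.trans (mem_idealTransform.1 hx)))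
  have hmem : s • x ∈ Algebra.adjoin S {v} := by
    have : Algebra.adjoin A {v} ≤ (Algebra.adjoin S {v}).restrictScalars A :=
      Algebra.adjoin_le (Algebra.subset_adjoin (R := S))
    exact this (h v hsx)
  obtain ⟨b, hb⟩ := (IsLocalization.map_units S (⟨s, hs⟩ : W)).exists_left_inv
  have h := Subalgebra.smul_mem _ hmem b
  rwa [← algebraMap_smul S s x, smul_smul, hb, one_smul] at h

end Localization

/-! ### A Prüfer criterion: integrally closed with `v ∈ D[v²]` for all `v`. -/

section Pruefer

variable {D K : Type*} [CommRing D] [IsDomain D] [Field K] [Algebra D K] [IsFractionRing D K]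

-- Induction on the degree: for the leading coefficient `a`, the element `a v` is integral, hence
-- some `b ∈ D`, and the top term `a v^(n+1)` folds into `b v^n`. Only the coefficient at `n`
-- changes, by `b = a v`, and `a` is itself a denominator of `v` with `b v = a v²` never needed.
omit [IsDomain D] in
open Polynomial in
theorem coeff_mem_of_aeval_eq_zero [IsIntegrallyClosed D] (v : K) (n : ℕ) (p : D[X])
    (hp : p.natDegree ≤ n) (h : aeval v p = 0) (i : ℕ) :
    ∃ g h : D, (∃ g' : D, algebraMap D K g' = algebraMap D K g * v) ∧
      (∃ h' : D, algebraMap D K h' = algebraMap D K h * v) ∧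
      algebraMap D K (p.coeff i) = algebraMap D K g + algebraMap D K h * v := by
  induction n generalizing p i with
  | zero =>
    rw [Nat.le_zero, natDegree_eq_zero] at hp
    obtain ⟨c, rfl⟩ := hp
    have hc : c = 0 := by simpa using h
    exact ⟨0, 0, ⟨0, by simp⟩, ⟨0, by simp⟩, by simp [hc]⟩
  | succ n ih =>
    rcases hp.lt_or_eq with hlt | heq
    · exact ih p (Nat.lt_succ_iff.1 hlt) h i
    obtain ⟨b, hb⟩ := IsIntegrallyClosed.isIntegral_iff.1
      (isIntegral_leadingCoeff_smul p v h)
    rw [Algebra.smul_def] at hb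
    have hlc : p.leadingCoeff = p.coeff (n + 1) := by rw [leadingCoeff, heq]
    set a := p.leadingCoeff
    have hq : (p.eraseLead + C b * X ^ n).natDegree ≤ n := by
      refine natDegree_add_le_of_degree_le ?_ (natDegree_C_mul_X_pow_le b n)
      simpa [heq] using p.eraseLead_natDegree_le
    have hqv : aeval v (p.eraseLead + C b * X ^ n) = 0 := by
      have := congrArg (aeval v) p.eraseLead_add_C_mul_X_pow
      rw [heq, h] at this
      simp only [map_add, map_mul, aeval_C, map_pow, aeval_X] at this ⊢
      rw [hb, ← this]
      ring
    obtain ⟨g, k, ⟨g', hg⟩, ⟨k', hk⟩, hi⟩ := ih _ hq hqv i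
    rw [coeff_add, coeff_C_mul_X_pow] at hi
    by_cases hin : i = n + 1
    · refine ⟨a, 0, ⟨b, hb⟩, ⟨0, by simp⟩, ?_⟩
      rw [hin, ← hlc]
      simp
    · rw [eraseLead_coeff_of_ne i (by rwa [heq])] at hi
      by_cases hi' : i = n
      · refine ⟨g, k - a, ⟨g', hg⟩, ⟨k' - b, by simp only [map_sub, hk, hb]; ring⟩, ?_⟩
        rw [if_pos hi', map_add, hb] at hi
        rw [map_sub]
        linear_combination hi
      · refine ⟨g, k, ⟨g', hg⟩, ⟨k', hk⟩, ?_⟩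
        rwa [if_neg hi', add_zero] at hi

omit [IsDomain D] in
theorem exists_inverse_pair_of_mem_adjoin_sq [IsIntegrallyClosed D] {v : K}
    (hv : v ∈ Algebra.adjoin D {v ^ 2}) :
    ∃ g h : D, (∃ g' : D, algebraMap D K g' = algebraMap D K g * v) ∧
      (∃ h' : D, algebraMap D K h' = algebraMap D K h * v) ∧
      1 = algebraMap D K g + algebraMap D K h * v := by
  rw [Algebra.adjoin_singleton_eq_range_aeval] at hv
  obtain ⟨p, hp⟩ := hv
  have hp : Polynomial.aeval (v ^ 2) p = v := hp
  -- From `v = p(v²)`, the polynomial `X - p(X²)` kills `v`, and its coefficient at `X` is 1.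
  obtain ⟨g, h, hg, hh, e⟩ := coeff_mem_of_aeval_eq_zero v _
    (Polynomial.X - Polynomial.expand D 2 p) le_rfl
    (by rw [map_sub, Polynomial.expand_aeval, hp, Polynomial.aeval_X, sub_self]) 1
  refine ⟨g, h, hg, hh, ?_⟩
  rw [← e, Polynomial.coeff_sub, Polynomial.coeff_X_one,
    Polynomial.coeff_expand (by norm_num), if_neg (by norm_num)]
  simp

theorem isUnit_span_singleton_add [IsIntegrallyClosed D]
    (h : ∀ v : K, v ∈ Algebra.adjoin D {v ^ 2}) {a b : D} (ha : a ≠ 0) :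
    IsUnit (((Ideal.span {a} : Ideal D) : FractionalIdeal D⁰ K) + (Ideal.span {b} : Ideal D)) := by
  have ha' : algebraMap D K a ≠ 0 := by simpa using ha
  obtain ⟨g, k, ⟨g', hg⟩, ⟨k', hk⟩, e⟩ :=
    exists_inverse_pair_of_mem_adjoin_sq (h (algebraMap D K b / algebraMap D K a))
  rw [← FractionalIdeal.coeIdeal_sup]
  set v := algebraMap D K b / algebraMap D K a
  have hb : algebraMap D K b = algebraMap D K a * v := by simp [v, mul_div_cancel₀ _ ha']
  have hgb : g * b = g' * a := by
    apply IsFractionRing.injective D K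
    simp only [map_mul, hg, hb]; ring
  have hkb : k * b = k' * a := by
    apply IsFractionRing.injective D K
    simp only [map_mul, hk, hb]; ring
  have ea : a = g * a + k * b := by
    apply IsFractionRing.injective D K
    simp only [map_mul, map_add, hb]
    linear_combination (algebraMap D K a) * e
  -- With `v = b / a`, the relations `g v, k v ∈ D` put the product inside `(a)`, and `1 = g + k v`
  -- gives the reverse inclusion.
  have key : (Ideal.span {a} ⊔ Ideal.span {b}) * (Ideal.span {g} ⊔ Ideal.span {k}) =
      Ideal.span {a} := by
    rw [Ideal.sup_mul, Ideal.mul_sup, Ideal.mul_sup]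
    simp only [Ideal.span_singleton_mul_span_singleton]
    apply le_antisymm
    · refine sup_le (sup_le ?_ ?_) (sup_le ?_ ?_) <;>
        rw [Ideal.span_singleton_le_iff_mem, Ideal.mem_span_singleton]
      · exact dvd_mul_right a g
      · exact dvd_mul_right a k
      · exact ⟨g', by linear_combination hgb⟩
      · exact ⟨k', by linear_combination hkb⟩
    · rw [Ideal.span_singleton_le_iff_mem]
      have hmem : a * g + b * k ∈ Ideal.span {a * g} ⊔ Ideal.span {a * k} ⊔
          (Ideal.span {b * g} ⊔ Ideal.span {b * k}) :=
        Ideal.add_mem _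
          (Submodule.mem_sup_left (Submodule.mem_sup_left (Ideal.mem_span_singleton_self _)))
          (Submodule.mem_sup_right (Submodule.mem_sup_right (Ideal.mem_span_singleton_self _)))
      rwa [mul_comm a g, mul_comm b k, ← ea, mul_comm g a, mul_comm k b] at hmem
  have hu : IsUnit ((Ideal.span {a} : Ideal D) : FractionalIdeal D⁰ K) := by
    rw [FractionalIdeal.coeIdeal_span_singleton]
    exact IsUnit.of_mul_eq_one _ (FractionalIdeal.spanSingleton_mul_inv K ha')
  rw [← key, FractionalIdeal.coeIdeal_mul] at hu
  exact isUnit_of_mul_isUnit_left hu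

theorem isPruferDomain_of_forall_mem_adjoin_sq [IsIntegrallyClosed D]
    (h : ∀ v : K, v ∈ Algebra.adjoin D {v ^ 2}) : IsPruferDomain D K := by
  suffices H : ∀ n : ℕ, ∀ t : Finset D, t.card ≤ n → (∃ a ∈ t, a ≠ 0) →
      IsUnit ((Ideal.span (t : Set D) : Ideal D) : FractionalIdeal D⁰ K) by
    rintro I hI ⟨t, rfl⟩
    refine H _ t le_rfl ?_
    by_contra! hc
    exact hI (Ideal.span_eq_bot.2 hc)
  classical
  intro n
  induction n with
  | zero =>
    rintro t ht ⟨a, hat, -⟩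
    simp_all
  | succ n ih =>
    rintro t ht ⟨a, hat, ha⟩
    by_cases h1 : t.erase a = ∅
    · have : t = {a} := by rw [← Finset.insert_erase hat, h1]; rfl
      rw [this, Finset.coe_singleton, FractionalIdeal.coeIdeal_span_singleton]
      exact IsUnit.of_mul_eq_one _ (FractionalIdeal.spanSingleton_mul_inv K (by simpa using ha))
    obtain ⟨b, hb⟩ := Finset.nonempty_iff_ne_empty.2 h1
    obtain ⟨hba, hbt⟩ := Finset.mem_erase.1 hb
    set s := (t.erase a).erase b
    have hcard : s.card + 2 ≤ n + 1 := by
      change ((t.erase a).erase b).card + 2 ≤ n + 1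
      have h2 := Finset.card_erase_of_mem hb
      have h3 := Finset.card_erase_of_mem hat
      have h4 := Finset.card_pos.2 ⟨b, hb⟩
      have h5 := Finset.card_pos.2 ⟨a, hat⟩
      omega
    have ht' : t = insert a (insert b s) := by
      rw [Finset.insert_erase hb, Finset.insert_erase hat]
    set X : FractionalIdeal D⁰ K := ((Ideal.span {a} : Ideal D) : FractionalIdeal D⁰ K)
    set Y : FractionalIdeal D⁰ K := ((Ideal.span {b} : Ideal D) : FractionalIdeal D⁰ K)
    set Z : FractionalIdeal D⁰ K := ((Ideal.span (s : Set D) : Ideal D) : FractionalIdeal D⁰ K)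
    have hXYZ : ((Ideal.span (t : Set D) : Ideal D) : FractionalIdeal D⁰ K) = X + (Y + Z) := by
      rw [ht', Finset.coe_insert, Finset.coe_insert, Ideal.span_insert, Ideal.span_insert,
        FractionalIdeal.coeIdeal_sup, FractionalIdeal.coeIdeal_sup]
    have hXY : IsUnit (X + Y) := isUnit_span_singleton_add h ha
    have hXZ : IsUnit (X + Z) := by
      have := ih (insert a s) ((Finset.card_insert_le _ _).trans (by omega))
        ⟨a, Finset.mem_insert_self _ _, ha⟩
      rwa [Finset.coe_insert, Ideal.span_insert, FractionalIdeal.coeIdeal_sup] at this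
    rw [hXYZ]
    by_cases hYZ : ∃ c ∈ insert b s, c ≠ 0
    · have hYZ : IsUnit (Y + Z) := by
        have := ih (insert b s) ((Finset.card_insert_le _ _).trans (by omega)) hYZ
        rwa [Finset.coe_insert, Ideal.span_insert, FractionalIdeal.coeIdeal_sup] at this
      -- Both sides agree up to the multiplicity of `X * Y * Z`, which is immaterial because
      -- addition of fractional ideals is idempotent.
      have hprod : (X + Y) * (X + Z) * (Y + Z) = (X + (Y + Z)) * (X * Y + X * Z + Y * Z) := by
        have e1 : X * Y * Z + X * Y * Z = X * Y * Z := by rw [← FractionalIdeal.sup_eq_add, sup_idem]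
        calc (X + Y) * (X + Z) * (Y + Z)
            = X * X * Y + X * X * Z + X * Y * Y + X * Z * Z + Y * Y * Z + Y * Z * Z +
              (X * Y * Z + X * Y * Z) := by ring
          _ = X * X * Y + X * X * Z + X * Y * Y + X * Z * Z + Y * Y * Z + Y * Z * Z +
              ((X * Y * Z + X * Y * Z) + X * Y * Z) := by rw [e1, e1]
          _ = _ := by ring
      exact isUnit_of_mul_isUnit_left (hprod ▸ (hXY.mul hXZ).mul hYZ)
    · push Not at hYZ
      have hb0 : b = 0 := hYZ b (Finset.mem_insert_self _ _)
      have hY : Y = 0 := by simp [Y, hb0]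
      rwa [hY, zero_add]

end Pruefer

/-! ### Radical membership in extended ideals. -/

section Scaling

variable {A E : Type*} [CommRing A] [CommRing E] [Algebra A E]

open Polynomial in
theorem mem_radical_map_of_aeval_scaleRoots_eq_zero {I : Ideal A} {m : A} (hm : m ∈ I) {p : A[X]}
    (hp : p.Monic) {v : E} (hv : aeval v (p.scaleRoots m) = 0) :
    v ∈ (I.map (algebraMap A E)).radical := by
  refine ⟨p.natDegree, ?_⟩
  rw [aeval_eq_sum_range, natDegree_scaleRoots, Finset.sum_range_succ,
    coeff_scaleRoots_natDegree, hp.leadingCoeff, one_smul] at hv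
  rw [eq_neg_of_add_eq_zero_right hv]
  refine neg_mem (sum_mem fun i hi => ?_)
  rw [Algebra.smul_def]
  refine Ideal.mul_mem_right _ _ (Ideal.mem_map_of_mem _ ?_)
  rw [coeff_scaleRoots]
  exact Ideal.mul_mem_left _ _
    (Ideal.pow_mem_of_mem _ hm _ (Nat.sub_pos_of_lt (Finset.mem_range.1 hi)))

/-- Modulo `Q`, `v (1 - v y) = 0` with `v y` nilpotent, so `1 - v y` is a unit. -/
theorem mem_of_mem_radical_of_eq_add_sq_mul {Q : Ideal E} {v a y : E} (hv : v ∈ Q.radical)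
    (ha : a ∈ Q) (h : v = a + v ^ 2 * y) : v ∈ Q := by
  have key : ∀ k : ℕ, v - v * (v * y) ^ k ∈ Q := by
    intro k
    induction k with
    | zero => simp
    | succ k ih =>
      have : v - v * (v * y) ^ (k + 1) = (v - v * (v * y) ^ k) + (v * y) ^ k * a := by
        linear_combination (v * y) ^ k * h
      rw [this]
      exact add_mem ih (Q.mul_mem_left _ ha)
  obtain ⟨n, hn⟩ := hv
  have h1 : v * (v * y) ^ n ∈ Q := by
    rw [mul_pow]
    exact Q.mul_mem_left _ (Q.mul_mem_right _ hn)
  simpa using add_mem (key n) h1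

end Scaling

/-! ### Integral elements over a local ring. -/

section LocalRing

open IsLocalRing

variable {A K : Type*} [CommRing A] [IsDomain A] [IsLocalRing A] [Field K] [Algebra A K]
  [IsFractionRing A K]

-- For `v = m z`, an integral equation of `z` scaled by `m` makes `v` nilpotent modulo `M A[v]`.
-- Then `v ∈ A[v²]` puts `v` in `M A[v]`, so `A[v] = A + M A[v]`, and Nakayama gives `A[v] = A`.
omit [IsDomain A] [IsFractionRing A K] in
theorem mem_bot_of_mem_adjoin_sq {m : A} (hm : m ∈ maximalIdeal A) {z : K} (hz : IsIntegral A z)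
    (h : m • z ∈ Algebra.adjoin A {(m • z) ^ 2}) : m • z ∈ (⊥ : Subalgebra A K) := by
  set v := m • z with hv
  have hvint : IsIntegral A v := hz.smul m
  set E := Algebra.adjoin A {v}
  set Q : Ideal E := (maximalIdeal A).map (algebraMap A E)
  let vE : E := ⟨v, Algebra.self_mem_adjoin_singleton A v⟩
  have hle : Algebra.adjoin A {v ^ 2} ≤ E :=
    Algebra.adjoin_le (Set.singleton_subset_iff.2 (pow_mem vE.2 2))
  have hrad : vE ∈ Q.radical := by
    obtain ⟨p, hp, hpz⟩ := hz
    refine mem_radical_map_of_aeval_scaleRoots_eq_zero hm hp (Subtype.ext ?_)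
    have := Polynomial.scaleRoots_aeval_eq_zero (r := m) (a := z) (p := p) hpz
    rw [← Algebra.smul_def] at this
    rw [← Subalgebra.aeval_coe]
    exact this
  obtain ⟨a, y, hy, hay⟩ := exists_eq_add_mul_of_mem_adjoin h
  have hE : vE = algebraMap A E a + vE ^ 2 * ⟨y, hle hy⟩ := Subtype.ext hay
  have hQ : vE ∈ Q := by
    by_cases ha : a ∈ maximalIdeal A
    · exact mem_of_mem_radical_of_eq_add_sq_mul hrad (Ideal.mem_map_of_mem _ ha) hE
    -- If `a` is a unit, then `a = v - v² y` lies in the radical of `Q`, so `Q` is the whole ring.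
    · have hau : IsUnit (algebraMap A E a) := (notMem_maximalIdeal.1 ha).map _
      have : algebraMap A E a ∈ Q.radical := by
        rw [← sub_eq_of_eq_add hE]
        exact sub_mem hrad (Ideal.mul_mem_right _ _ (Ideal.pow_mem_of_mem _ hrad 2 two_pos))
      rw [Ideal.radical_eq_top.1 (Ideal.eq_top_of_isUnit_mem _ this hau)]
      trivial
  have hfin : (⊤ : Submodule A E).FG := by
    have : Module.Finite A E := Module.Finite.iff_fg.2 hvint.fg_adjoin_singleton
    exact Module.Finite.fg_top
  have hnak : (⊤ : Submodule A E) ≤ Subalgebra.toSubmodule ⊥ := by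
    refine Submodule.le_of_le_smul_of_le_jacobson_bot hfin (maximalIdeal_le_jacobson ⊥) ?_
    rintro ⟨e, he⟩ -
    obtain ⟨b, x, hx, rfl⟩ := exists_eq_add_mul_of_mem_adjoin he
    refine Submodule.mem_sup.2 ⟨algebraMap A E b, Subalgebra.algebraMap_mem _ b,
      vE * ⟨x, hx⟩, ?_, rfl⟩
    rw [Ideal.smul_top_eq_map]
    exact Q.mul_mem_right _ hQ
  obtain ⟨b, hb⟩ := Algebra.mem_bot.1 (hnak (Submodule.mem_top (x := vE)))
  exact Algebra.mem_bot.2 ⟨b, congrArg Subtype.val hb⟩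

omit [IsDomain A] [IsFractionRing A K] in
theorem HasTransformSimpleOverrings.idealTransform_maximalIdeal_le
    (h : HasTransformSimpleOverrings A K) {v : K} (hv : v ∉ (⊥ : Subalgebra A K)) :
    idealTransform K (maximalIdeal A) ≤ Algebra.adjoin A {v} := by
  refine fun x hx => h v (mem_idealTransform.2 (le_trans ?_ (mem_idealTransform.1 hx)))
  exact le_maximalIdeal (mt denomIdeal_eq_top_iff.1 hv)

omit [IsDomain A] [IsLocalRing A] [IsFractionRing A K] in
theorem mem_idealTransform_of_smul_mem {I : Ideal A} {d : A} {x : K} (hd : d ∈ I)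
    (h : d • x ∈ idealTransform K I) : d ∈ (denomIdeal A x).radical := by
  obtain ⟨n, hn⟩ := mem_radical_denomIdeal.1 (mem_idealTransform.1 h hd)
  refine mem_radical_denomIdeal.2 ⟨n + 1, ?_⟩
  rwa [pow_succ, mul_smul]

theorem exists_isIntegral_notMem_idealTransform (hA : HasNoetherianSpectrum A)
    (h : HasTransformSimpleOverrings A K) {u : K} (hu : u ∉ (⊥ : Subalgebra A K))
    (hint : IsIntegral A u) :
    ∃ f : K, IsIntegral A f ∧ f ∉ idealTransform K (maximalIdeal A) := by
  by_contra! hall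
  set M := maximalIdeal A
  set T := idealTransform K M
  -- Since `T ⊆ A[u]`, the negated claim makes `T` exactly the integral closure of `A` in `K`.
  have : Algebra.IsIntegral A T := ⟨fun x => by
    rw [← isIntegral_algHom_iff T.val Subtype.val_injective]
    exact adjoin_le_integralClosure hint (h.idealTransform_maximalIdeal_le hu x.2)⟩
  have hT : ∀ x : K, IsIntegral T x → x ∈ T := fun x hx => hall x (isIntegral_trans x hx)
  have : IsIntegrallyClosed T :=
    (isIntegrallyClosed_iff K).2 fun {x} hx => ⟨⟨x, hT x hx⟩, rfl⟩
  have hsq : ∀ v : K, v ∈ Algebra.adjoin T {v ^ 2} := by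
    intro v
    by_cases hv : v ∈ T
    · exact Subalgebra.algebraMap_mem _ (⟨v, hv⟩ : T)
    have hv2 : v ^ 2 ∉ (⊥ : Subalgebra A K) := fun hc => hv <| hall v <| by
      obtain ⟨b, hb⟩ := Algebra.mem_bot.1 hc
      exact IsIntegral.of_pow two_pos (hb ▸ isIntegral_algebraMap)
    have hmem : v ∈ Algebra.adjoin A {v ^ 2} := by
      refine h _ (mem_idealTransform.2 fun d hd => ?_)
      refine mem_idealTransform_of_smul_mem
        (le_maximalIdeal (mt denomIdeal_eq_top_iff.1 hv2) hd) (hall _ ?_)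
      refine IsIntegral.of_pow two_pos ?_
      obtain ⟨b, hb⟩ := Algebra.mem_bot.1 (mem_denomIdeal.1 hd)
      rw [smul_pow, sq d, mul_smul, ← hb]
      exact isIntegral_algebraMap.smul d
    have hle : Algebra.adjoin A {v ^ 2} ≤ (Algebra.adjoin T {v ^ 2}).restrictScalars A :=
      Algebra.adjoin_le (Algebra.subset_adjoin (R := T))
    exact hle hmem
  have hPr := isPruferDomain_of_forall_mem_adjoin_sq hsq
  have hinj : Function.Injective (algebraMap A T) := FaithfulSMul.algebraMap_injective A T
  obtain ⟨J, hJM, hJ, hMJ⟩ := hA.exists_fg_le_radical M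
  have hJ0 : J.map (algebraMap A T) ≠ ⊥ := by
    intro h0
    rw [Ideal.map_eq_bot_iff_of_injective hinj] at h0
    obtain ⟨⟨a, b⟩, hab⟩ := IsLocalization.surj A⁰ u
    have hb : (b : A) ∈ denomIdeal A u := by
      rw [mem_denomIdeal, Algebra.smul_def, mul_comm, hab]
      exact Subalgebra.algebraMap_mem _ a
    have hb' := hMJ (le_maximalIdeal (mt denomIdeal_eq_top_iff.1 hu) hb)
    rw [h0, Ideal.radical_bot_of_isReduced] at hb'
    exact nonZeroDivisors.coe_ne_zero b hb'
  obtain ⟨X, hX⟩ := (hPr _ hJ0 (hJ.map _)).exists_right_inv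
  -- The inverse of `J T` lies in `T`: a power of each `d ∈ M` is in `J`, hence multiplies `x` into
  -- `T`, and a further power of `d` lands in `A`. So `J T = T`.
  have hX1 : X ≤ 1 := by
    intro x hx
    refine (FractionalIdeal.mem_one_iff _).2 ⟨⟨x, mem_idealTransform.2 fun d hd => ?_⟩, rfl⟩
    obtain ⟨n, hn⟩ := hMJ hd
    have h1 : algebraMap T K (algebraMap A T (d ^ n)) * x ∈ (1 : FractionalIdeal T⁰ K) := by
      rw [← hX]
      exact FractionalIdeal.mul_mem_mul
        (FractionalIdeal.mem_coeIdeal_of_mem _ (Ideal.mem_map_of_mem _ hn)) hx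
    obtain ⟨y, hy⟩ := (FractionalIdeal.mem_one_iff _).1 h1
    have h2 : d ^ n • x ∈ T := by
      rw [Algebra.smul_def]
      exact (congrArg (· ∈ T) hy).mp y.2
    obtain ⟨k, hk⟩ := mem_radical_denomIdeal.1 (mem_idealTransform.1 h2 hd)
    exact mem_radical_denomIdeal.2 ⟨k + n, by rwa [pow_add, mul_smul]⟩
  have hJtop : J.map (algebraMap A T) = ⊤ := by
    rw [eq_top_iff, ← FractionalIdeal.coeIdeal_le_coeIdeal K, FractionalIdeal.coeIdeal_top, ← hX]
    calc _ ≤ (J.map (algebraMap A T) : FractionalIdeal T⁰ K) * 1 := mul_le_mul_right hX1 _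
      _ = _ := mul_one _
  rw [Ideal.map_eq_top_iff _ hinj (algebraMap_isIntegral_iff.2 inferInstance)] at hJtop
  exact (maximalIdeal.isMaximal A).ne_top (top_le_iff.1 (hJtop ▸ hJM))

theorem exists_mem_idealTransform_sq_mem_bot (hA : HasNoetherianSpectrum A)
    (h : HasTransformSimpleOverrings A K) {u : K} (hu : u ∉ (⊥ : Subalgebra A K))
    (hint : IsIntegral A u) (huT : u ∈ idealTransform K (maximalIdeal A)) :
    ∃ w ∈ idealTransform K (maximalIdeal A), w ∉ (⊥ : Subalgebra A K) ∧
      w ^ 2 ∈ (⊥ : Subalgebra A K) := by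
  obtain ⟨f, hf, hfT⟩ := exists_isIntegral_notMem_idealTransform hA h hu hint
  obtain ⟨m, hm, hmf⟩ : ∃ m ∈ maximalIdeal A, m • f ∉ (⊥ : Subalgebra A K) := by
    by_contra! hc
    exact hfT (mem_idealTransform.2 (le_trans hc Ideal.le_radical))
  -- The witness is `w = u - a = m (f y)`. Were `w²` outside `A`, then `w ∈ T ⊆ A[w²]`, and Nakayama
  -- would put `w` in `A`.
  obtain ⟨a, y, hy, e⟩ :=
    exists_eq_add_mul_of_mem_adjoin (h.idealTransform_maximalIdeal_le hmf huT)
  have hfy : IsIntegral A (f * y) := hf.mul (adjoin_le_integralClosure (hf.smul m) hy)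
  rw [smul_mul_assoc] at e
  have hv : m • (f * y) = u - algebraMap A K a := (sub_eq_of_eq_add' e).symm
  have hvT : m • (f * y) ∈ idealTransform K (maximalIdeal A) := by
    rw [hv]
    exact sub_mem huT (Subalgebra.algebraMap_mem _ a)
  have hvb : m • (f * y) ∉ (⊥ : Subalgebra A K) := fun hc =>
    hu (e ▸ add_mem (Subalgebra.algebraMap_mem _ a) hc)
  refine ⟨_, hvT, hvb, ?_⟩
  by_contra hc
  exact hvb (mem_bot_of_mem_adjoin_sq hm hfy (h.idealTransform_maximalIdeal_le hc hvT))

end LocalRing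

/-! ### Primes from maximal denominator radicals. -/

section Maximal

variable {A K : Type*} [CommRing A] [CommRing K] [Algebra A K]

/-- If `x y` lies in the maximal radical but `y` does not, then `y^n f` still avoids `N`; for
suitable `n`, `x^n` is a denominator of it, so maximality puts `x` in the radical. It is used with
`N = A` and with `N = T(M)`. -/
theorem exists_isPrime_radical_denomIdeal (hA : HasNoetherianSpectrum A) (N : Subalgebra A K)
    (hN : ∀ (y : A) (x : K), ¬ IsUnit y → y • x ∈ N → y ∈ (denomIdeal A x).radical)
    {f₀ : K} (hf₀ : IsIntegral A f₀) (hf₀N : f₀ ∉ N) :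
    ∃ f : K, (IsIntegral A f ∧ f ∉ N) ∧ (denomIdeal A f).radical.IsPrime ∧
      ∀ g : K, IsIntegral A g → g ∉ N → (denomIdeal A f).radical ≤ (denomIdeal A g).radical →
        (denomIdeal A g).radical ≤ (denomIdeal A f).radical := by
  obtain ⟨f, hf, hmax⟩ := hA.exists_maximal (p := fun f : K => IsIntegral A f ∧ f ∉ N)
    (denomIdeal A) f₀ ⟨hf₀, hf₀N⟩
  refine ⟨f, hf, ⟨fun htop => ?_, ?_⟩, fun g hg hgN => hmax g ⟨hg, hgN⟩⟩
  · rw [Ideal.radical_eq_top, denomIdeal_eq_top_iff] at htop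
    exact hf.2 (bot_le (a := N) htop)
  · intro x y hxy
    by_contra! hc
    have hy : ¬ IsUnit y := fun hu => hc.1 ((Ideal.mul_unit_mem_iff_mem _ hu).1 hxy)
    obtain ⟨n, hn⟩ := mem_radical_denomIdeal.1 hxy
    have hyn : y ^ n • f ∉ N := by
      intro hmem
      rcases Nat.eq_zero_or_pos n with rfl | hpos
      · exact hf.2 (by simpa using hmem)
      · exact hc.2 (Ideal.mem_radical_of_pow_mem
          (hN _ _ (by rwa [isUnit_pow_iff hpos.ne']) hmem))
    refine hc.1 (hmax _ ⟨hf.1.smul _, hyn⟩ (Ideal.radical_mono (denomIdeal_le_smul _ f)) ?_)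
    exact mem_radical_denomIdeal.2 ⟨n, by rwa [← mul_smul, ← mul_pow]⟩

end Maximal

/-! ### Localizing at the prime of an element. -/

section LocalizationAtDenominators

open IsLocalRing

variable {A K : Type*} [CommRing A] [Field K] [Algebra A K]
  (S : Type*) [CommRing S] [Algebra A S] [Algebra S K] [IsScalarTower A S K]

theorem notMem_bot_of_isLocalization_radical_denomIdeal {f : K}
    [(denomIdeal A f).radical.IsPrime] [IsLocalization.AtPrime S (denomIdeal A f).radical] :
    f ∉ (⊥ : Subalgebra S K) := by
  rw [mem_bot_iff_of_isLocalization (denomIdeal A f).radical.primeCompl]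
  rintro ⟨s, hs, hsf⟩
  exact hs (Ideal.le_radical (mem_denomIdeal.2 hsf))

theorem mem_idealTransform_maximalIdeal_of_isLocalization {f : K} [IsLocalRing S]
    [(denomIdeal A f).radical.IsPrime] [IsLocalization.AtPrime S (denomIdeal A f).radical] :
    f ∈ idealTransform K (maximalIdeal S) := by
  rw [mem_idealTransform,
    ← IsLocalization.AtPrime.map_eq_maximalIdeal (denomIdeal A f).radical S,
    Ideal.map_le_iff_le_comap]
  exact fun _ ha => algebraMap_mem_radical_denomIdeal ha

end LocalizationAtDenominators

/-! ### Integral closedness and the conclusion. -/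

section IntegrallyClosed

open IsLocalRing

variable {A K : Type*} [CommRing A] [IsDomain A] [Field K] [Algebra A K] [IsFractionRing A K]

theorem exists_sq_mem_bot_of_isPrime_radical_denomIdeal (hA : HasNoetherianSpectrum A)
    (h : HasTransformSimpleOverrings A K) {f : K} (hf : IsIntegral A f)
    (hP : (denomIdeal A f).radical.IsPrime) :
    ∃ g : K, g ^ 2 ∈ (⊥ : Subalgebra A K) ∧ g ∈ idealTransform K (denomIdeal A f).radical ∧
      ∀ s ∉ (denomIdeal A f).radical, s • g ∉ (⊥ : Subalgebra A K) := by
  set P := (denomIdeal A f).radical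
  let S := Localization.subalgebra.ofField K P.primeCompl P.primeCompl_le_nonZeroDivisors
  have : IsLocalization.AtPrime S P :=
    Localization.subalgebra.isLocalization_ofField K P.primeCompl _
  have : IsLocalRing S := IsLocalization.AtPrime.isLocalRing S P
  obtain ⟨w, hwT, hw, hw2⟩ := exists_mem_idealTransform_sq_mem_bot
    (hA.of_isLocalization P.primeCompl S) (h.of_isLocalization (S := S) hA P.primeCompl)
    (notMem_bot_of_isLocalization_radical_denomIdeal (A := A) S (f := f)) hf.tower_top
    (mem_idealTransform_maximalIdeal_of_isLocalization (A := A) S)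
  rw [← IsLocalization.AtPrime.map_eq_maximalIdeal P S] at hwT
  obtain ⟨s, hs, hsw⟩ := hA.exists_smul_mem_idealTransform P.primeCompl P hwT
  obtain ⟨r, hr, hrw⟩ := (mem_bot_iff_of_isLocalization P.primeCompl).1 hw2
  rw [mem_bot_iff_of_isLocalization P.primeCompl] at hw
  refine ⟨r • s • w, ?_, Subalgebra.smul_mem _ hsw r, fun t ht hc => hw ?_⟩
  · have : (r • s • w) ^ 2 = (r * s ^ 2) • r • w ^ 2 := by
      simp only [Algebra.smul_def, map_mul, map_pow]; ring
    rw [this]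
    exact Subalgebra.smul_mem _ hrw _
  · exact ⟨t * (r * s), mul_mem (S := Submonoid A) ht (mul_mem hr hs), by
      rwa [mul_smul, mul_smul]⟩

theorem mem_bot_of_isIntegral_of_mem_idealTransform [IsLocalRing A]
    (hA : HasNoetherianSpectrum A) (h : HasTransformSimpleOverrings A K) {u : K}
    (hint : IsIntegral A u) (huT : u ∈ idealTransform K (maximalIdeal A)) :
    u ∈ (⊥ : Subalgebra A K) := by
  by_contra hu
  set T := idealTransform K (maximalIdeal A)
  obtain ⟨f₀, hf₀, hf₀T⟩ := exists_isIntegral_notMem_idealTransform hA h hu hint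
  obtain ⟨f, ⟨hf, hfT⟩, hP, hmax⟩ := exists_isPrime_radical_denomIdeal hA T
    (fun y x hy hyx => mem_idealTransform_of_smul_mem ((mem_maximalIdeal y).2 hy) hyx) hf₀ hf₀T
  obtain ⟨g, hg2, hgP, hgs⟩ := exists_sq_mem_bot_of_isPrime_radical_denomIdeal hA h hf hP
  have hg : IsIntegral A g := by
    obtain ⟨b, hb⟩ := Algebra.mem_bot.1 hg2
    exact IsIntegral.of_pow two_pos (hb ▸ isIntegral_algebraMap)
  -- As `f ∉ T`, some `x ∈ M` avoids the prime `P = (denomIdeal A f).radical`.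
  obtain ⟨x, hxM, hxP⟩ := SetLike.not_le_iff_exists.1 (mt mem_idealTransform.2 hfT)
  -- Since `u ∈ T ⊆ A[u]`, `T` equals the finite module `A[u]`, so one power of `x` serves all of
  -- `T`.
  obtain ⟨k, hk⟩ : ∃ k : ℕ, ∀ b ∈ T, x ^ k • b ∈ (⊥ : Subalgebra A K) := by
    obtain ⟨t, ht⟩ := hint.fg_adjoin_singleton
    have hTt : Subalgebra.toSubmodule T ≤ Submodule.span A (t : Set K) := by
      rw [ht]; exact h.idealTransform_maximalIdeal_le hu
    have huT' : Subalgebra.toSubmodule (Algebra.adjoin A {u}) ≤ Subalgebra.toSubmodule T :=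
      Algebra.adjoin_le (Set.singleton_subset_iff.2 huT)
    have ht' : ∀ b ∈ t, ∃ n : ℕ, x ^ n • b ∈ (⊥ : Subalgebra A K) := fun b hb =>
      mem_radical_denomIdeal.1 (mem_idealTransform.1
        (huT' (ht ▸ Submodule.subset_span hb)) hxM)
    choose! n hn using ht'
    refine ⟨t.sup n, fun b hb => ?_⟩
    have := hTt hb
    clear hb
    induction this using Submodule.span_induction with
    | mem b hb => exact pow_smul_mem_of_le (Finset.le_sup hb) (hn b hb)
    | zero => simp
    | add b c _ _ hb hc => rw [smul_add]; exact add_mem hb hc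
    | smul a b _ hb => rw [smul_comm]; exact Subalgebra.smul_mem _ hb a
  have hxk : x ^ k ∉ (denomIdeal A f).radical := fun hc => hxP (hP.mem_of_pow_mem k hc)
  have hsq : (x ^ k • g) ^ 2 ∈ (⊥ : Subalgebra A K) := by
    rw [smul_pow]
    exact Subalgebra.smul_mem _ hg2 _
  -- Here `x^k g ∉ A`, so `u ∈ T ⊆ A[x^k g] = A + A x^k g`.
  obtain ⟨a, c, e⟩ := exists_eq_add_smul_of_sq_mem hsq
    (h.idealTransform_maximalIdeal_le (hgs _ hxk) huT)
  have hcT : x ^ k • c • g ∈ T := by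
    rw [smul_comm, ← sub_eq_of_eq_add' e]
    exact sub_mem huT (Subalgebra.algebraMap_mem _ a)
  -- Otherwise maximality of `P` would confine the denominators of `c g` to `P`; but `x^k c g = u -
  -- a ∈ T`, so a power of `x` is one of them.
  have hc : c • g ∈ T := by
    by_contra hc
    refine hxP (hmax (c • g) (hg.smul c) hc
      (mem_idealTransform.1 (Subalgebra.smul_mem _ hgP c)) ?_)
    obtain ⟨n, hn⟩ := mem_radical_denomIdeal.1 (mem_idealTransform.1 hcT hxM)
    exact mem_radical_denomIdeal.2 ⟨n + k, by rwa [pow_add, mul_smul]⟩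
  refine hu (e ▸ add_mem (Subalgebra.algebraMap_mem _ a) ?_)
  rw [smul_comm]
  exact hk _ hc

theorem isIntegrallyClosed_of_hasTransformSimpleOverrings (hA : HasNoetherianSpectrum A)
    (h : HasTransformSimpleOverrings A K) : IsIntegrallyClosed A := by
  refine (isIntegrallyClosed_iff K).2 fun {x} hx => Algebra.mem_bot.1 ?_
  by_contra hxb
  obtain ⟨f, ⟨hf, -⟩, hP, -⟩ := exists_isPrime_radical_denomIdeal hA ⊥
    (fun y x _ hyx => Ideal.le_radical (mem_denomIdeal.2 hyx)) hx hxb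
  let S := Localization.subalgebra.ofField K (denomIdeal A f).radical.primeCompl
    (denomIdeal A f).radical.primeCompl_le_nonZeroDivisors
  have : IsLocalization.AtPrime S (denomIdeal A f).radical :=
    Localization.subalgebra.isLocalization_ofField K (denomIdeal A f).radical.primeCompl _
  have : IsLocalRing S := IsLocalization.AtPrime.isLocalRing S (denomIdeal A f).radical
  exact notMem_bot_of_isLocalization_radical_denomIdeal (A := A) S
    (mem_bot_of_isIntegral_of_mem_idealTransform
      (hA.of_isLocalization (denomIdeal A f).radical.primeCompl S)
      (h.of_isLocalization (S := S) hA (denomIdeal A f).radical.primeCompl) hf.tower_top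
      (mem_idealTransform_maximalIdeal_of_isLocalization (A := A) S))

omit [IsDomain A] in
theorem mem_adjoin_sq_of_hasTransformSimpleOverrings [IsIntegrallyClosed A]
    (h : HasTransformSimpleOverrings A K) (v : K) : v ∈ Algebra.adjoin A {v ^ 2} := by
  refine h _ (mem_idealTransform.2 fun d hd => Ideal.le_radical (mem_denomIdeal.2 ?_))
  obtain ⟨b, hb⟩ := Algebra.mem_bot.1 (mem_denomIdeal.1 hd)
  have hint : IsIntegral A (d • v) := by
    refine IsIntegral.of_pow two_pos ?_
    rw [smul_pow, sq d, mul_smul, ← hb]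
    exact isIntegral_algebraMap.smul d
  exact Algebra.mem_bot.2 (IsIntegrallyClosed.isIntegral_iff.1 hint)

theorem IsSQQRDomain.hasTransformSimpleOverrings (h : IsSQQRDomain A K) :
    HasTransformSimpleOverrings A K := by
  intro v x hx
  obtain ⟨Y, hY⟩ := h v
  have hv : v ∈ Algebra.adjoin A {v} := Algebra.self_mem_adjoin_singleton A v
  rw [hY] at hv ⊢
  simp only [Algebra.mem_iInf] at hv ⊢
  intro P hP
  -- As `v ∈ A_P`, it has a denominator `s ∉ P`; a power of `s` multiplies `x` into `A`, so `x ∈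
  -- A_P`.
  obtain ⟨a, s, hs, rfl⟩ := hv P hP
  have hs0 : algebraMap A K s ≠ 0 := by
    simpa using nonZeroDivisors.ne_zero (P.asIdeal.primeCompl_le_nonZeroDivisors hs)
  have hsv : s ∈ denomIdeal A (algebraMap A K a * (algebraMap A K s)⁻¹) := by
    rw [mem_denomIdeal, Algebra.smul_def, mul_comm, mul_assoc, inv_mul_cancel₀ hs0, mul_one]
    exact Subalgebra.algebraMap_mem _ a
  obtain ⟨n, hn⟩ := mem_radical_denomIdeal.1 (mem_idealTransform.1 hx hsv)
  obtain ⟨b, hb⟩ := Algebra.mem_bot.1 hn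
  refine ⟨b, s ^ n, pow_mem hs n, ?_⟩
  rw [hb, Algebra.smul_def, mul_comm, map_pow, inv_mul_cancel_left₀ (pow_ne_zero n hs0)]

end IntegrallyClosed

theorem theorem2p15 {R K : Type*} [CommRing R] [IsDomain R] [Field K] [Algebra R K]
    [IsFractionRing R K] (hR : IsSQQRDomain R K) (hspec : HasNoetherianSpectrum R) :
    IsPruferDomain R K := by
  have h := hR.hasTransformSimpleOverrings
  have := isIntegrallyClosed_of_hasTransformSimpleOverrings hspec h
  exact isPruferDomain_of_forall_mem_adjoin_sq (mem_adjoin_sq_of_hasTransformSimpleOverrings h)
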